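/- Let $N\ge 1$ be an integer and let $p,q\in[1,\infty]$, with $1/\infty=0$. For $a=(a_0,\dots,a_{N-1})\in\mathbb C^N$ put $T_N a(t)=\sum_{n=0}^{N-1}a_n e^{int}$, and let $$C_N(p\to q)=\sup_{a\in\mathbb C^N\setminus\{0\}}\frac{\|T_N a\|_{L^q}}{\|a\|_{\ell^p}},$$ where $\|a\|_{\ell^p}=\bigl(\sum_{n=0}^{N-1}|a_n|^p\bigr)^{1/p}$ for $p<\infty$ and $\|a\|_{\ell^\infty}=\max_n|a_n|$, and where $\|f\|_{L^q}=\bigl(\frac1{2\pi}\int_{-\pi}^{\pi}|f(t)|^q\,dt\bigr)^{1/q}$ for $q<\infty$ and $\|f\|_{L^\infty}=\max_{|t|\le\pi}|f(t)|$. Consider the following regions of the plane: $$\mathcal A=\{(x,y):\tfrac12\le x\le 1,\ 1-x\le y\le 1\},$$ $$\mathcal B=\{(x,y):0\le y\le\tfrac12,\ 0\le x\le 1-y\},$$ $$\mathcal C=\{(x,y):0\le x\le\tfrac12,\ \tfrac12\le y\le 1\}.$$ Their union is the unit square $[0,1]^2$. There exist positive absolute constants $c_{\mathcal B}$ and $c_{\mathcal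 C}$ (independent of $N$, $p$, $q$), where one can take $c_{\mathcal B}=2/\pi$, such that for all $N\ge1$ and all $p,q\in[1,\infty]$: - if $(1/p,1/q)\in\mathcal A$, then $C_N(p\to q)=1$; - if $(1/p,1/q)\in\mathcal B$, then $c_{\mathcal B}\,N^{1-\frac1q-\frac1p}\le C_N(p\to q)\le N^{1-\frac1q-\frac1p}$; - if $(1/p,1/q)\in\mathcal C$, then $c_{\mathcal C}\,N^{\frac12-\frac1p}\le C_N(p\to q)\le N^{\frac12-\frac1p}$. -/

import Mathlib

open MeasureTheory
open scoped ENNReal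

namespace TrigSum

/-- The trigonometric sum `f(t) = ∑_{n=0}^{N-1} a_n e^{int}`, i.e. the operator `T_N` applied
to `a ∈ ℂ^N`. -/
noncomputable def T (N : ℕ) (a : Fin N → ℂ) (t : ℝ) : ℂ :=
  ∑ n : Fin N, a n * Complex.exp (Complex.I * ((n : ℕ) : ℂ) * (t : ℂ))

/-- Normalized Lebesgue measure `dt / (2π)` on `(-π, π)`. -/
noncomputable def circleMeasure : Measure ℝ :=
  (ENNReal.ofReal (2 * Real.pi))⁻¹ • volume.restrict (Set.Ioo (-Real.pi) Real.pi)

/-- The best constant `C_N(p → q) = sup_{a ≠ 0} ‖T_N a‖_{L^q} / ‖a‖_{ℓ^p}`. It is taken in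
`[0, ∞]`, so that the supremum always exists. The `L^∞` norm is an essential supremum, which
for the continuous functions `T_N a` is the maximum over `[-π, π]`. -/
noncomputable def C (N : ℕ) (p q : ℝ≥0∞) : ℝ≥0∞ :=
  ⨆ (a : Fin N → ℂ) (_ : a ≠ 0),
    eLpNorm (T N a) q circleMeasure / ENNReal.ofReal ‖WithLp.toLp p a‖

/-- The point `(p → q) = (1/p, 1/q)`, with `1/∞ = 0`. -/
noncomputable def point (p q : ℝ≥0∞) : ℝ × ℝ := ((p⁻¹).toReal, (q⁻¹).toReal)

/-- Region `𝒜`. -/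
def regionA : Set (ℝ × ℝ) :=
  {x | 1 / 2 ≤ x.1 ∧ x.1 ≤ 1 ∧ 1 - x.1 ≤ x.2 ∧ x.2 ≤ 1}

/-- Region `ℬ`. -/
def regionB : Set (ℝ × ℝ) :=
  {x | 0 ≤ x.2 ∧ x.2 ≤ 1 / 2 ∧ 0 ≤ x.1 ∧ x.1 ≤ 1 - x.2}

/-- Region `𝒞`. -/
def regionC : Set (ℝ × ℝ) :=
  {x | 0 ≤ x.1 ∧ x.1 ≤ 1 / 2 ∧ 1 / 2 ≤ x.2 ∧ x.2 ≤ 1}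

end TrigSum

/-! Upper bounds. Everything follows from the Hausdorff–Young inequality with constant 1
(`eLpNorm_T_le`) for conjugate exponents `r ≤ 2 ≤ s`. Combined with monotonicity of `L^q` norms on a
probability space and Hölder's inequality on `ℂ^N`, it bounds `C N p q` by `N ^ (1/r - 1/p)`
whenever `q ≤ s` and `r ≤ p` (`C_le_rpow`). The choices `r = p`, `s = q` and `r = s = 2` settle
regions 𝒜, ℬ and 𝒞. Hausdorff–Young itself is reduced to finite dimensions. Sampling `T N a` at the
`N` points `t + 2πj/N` applies the DFT matrix, which has unimodular entries and is `√N` times a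
unitary. Riesz–Thorin for matrices (`sum_rpow_le_of_conjugate`) bounds the sum of the `s`-th powers
of the samples by `N ‖a‖_r ^ s`; integrating over `t` and using periodicity cancels the `N`. Lower
bounds. A single exponential gives 1. The Dirichlet kernel has size at least `2N/π` on an interval
of measure `1/N`, which gives ℬ. Rudin–Shapiro polynomials have unimodular coefficients and nearly
constant modulus, so even their `L¹` norm is comparable to `√N`, which gives 𝒞. -/

namespace TrigSum

/-! ### Riesz–Thorin interpolation for finite matrices -/

/-- The holomorphic family `w ↦ sgn(c) |c|^w`, which takes the value `c` at `w = 1` and vanishes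
identically for `c = 0`. -/
noncomputable def signedPow (c w : ℂ) : ℂ :=
  if c = 0 then 0 else c / ‖c‖ * Complex.exp (w * Real.log ‖c‖)

lemma signedPow_one (c : ℂ) : signedPow c 1 = c := by
  unfold signedPow
  split_ifs with h
  · exact h.symm
  · have hc : 0 < ‖c‖ := norm_pos_iff.mpr h
    have hc' : (‖c‖ : ℂ) ≠ 0 := by exact_mod_cast hc.ne'
    rw [one_mul, ← Complex.ofReal_exp, Real.exp_log hc]
    field_simp

lemma norm_signedPow {c w : ℂ} (hw : 0 < w.re) : ‖signedPow c w‖ = ‖c‖ ^ w.re := by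
  unfold signedPow
  split_ifs with h
  · simp [h, Real.zero_rpow hw.ne']
  · have hc : 0 < ‖c‖ := norm_pos_iff.mpr h
    rw [norm_mul, norm_div, Complex.norm_real, norm_norm, div_self hc.ne', one_mul,
      Complex.norm_exp, Real.rpow_def_of_pos hc]
    congr 1
    simp [mul_comm]

lemma differentiable_signedPow (c : ℂ) : Differentiable ℂ (signedPow c) := by
  unfold signedPow
  split_ifs with h <;> fun_prop

lemma norm_le_one_of_sum_rpow_le_one {ι : Type*} [Fintype ι] {x : ι → ℂ} {p : ℝ} (hp : 0 < p)
    (hx : ∑ i, ‖x i‖ ^ p ≤ 1) (i : ι) : ‖x i‖ ≤ 1 := by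
  have h : ‖x i‖ ^ p ≤ 1 :=
    (Finset.single_le_sum (f := fun i => ‖x i‖ ^ p) (fun j _ => by positivity)
      (Finset.mem_univ i)).trans hx
  by_contra! hlt
  exact absurd h (not_le.mpr (Real.one_lt_rpow hlt hp))

/-- The `ℓ¹ → ℓ^∞` edge of the interpolation; it also supplies boundedness on the whole strip. -/
lemma norm_bilin_le_mul_sum {ι κ : Type*} [Fintype ι] [Fintype κ] {A : κ → ι → ℂ}
    (hA : ∀ j n, ‖A j n‖ ≤ 1) (y : κ → ℂ) (x : ι → ℂ) :
    ‖∑ j, y j * ∑ n, A j n * x n‖ ≤ (∑ j, ‖y j‖) * ∑ n, ‖x n‖ := by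
  rw [Finset.sum_mul]
  refine (norm_sum_le _ _).trans (Finset.sum_le_sum fun j _ => ?_)
  rw [norm_mul]
  gcongr
  refine (norm_sum_le _ _).trans (Finset.sum_le_sum fun n _ => ?_)
  rw [norm_mul]
  exact mul_le_of_le_one_left (norm_nonneg _) (hA j n)

/-- The `ℓ² → ℓ²` edge, by Cauchy–Schwarz. -/
lemma norm_bilin_le_sqrt {ι κ : Type*} [Fintype ι] [Fintype κ] {A : κ → ι → ℂ} {M : ℝ}
    (hA : ∀ x : ι → ℂ, ∑ j, ‖∑ n, A j n * x n‖ ^ 2 ≤ M * ∑ n, ‖x n‖ ^ 2) (hM : 0 ≤ M)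
    {y : κ → ℂ} {x : ι → ℂ} (hy : ∑ j, ‖y j‖ ^ 2 ≤ 1) (hx : ∑ n, ‖x n‖ ^ 2 ≤ 1) :
    ‖∑ j, y j * ∑ n, A j n * x n‖ ≤ √M := by
  refine Real.le_sqrt_of_sq_le ?_
  have h1 : ‖∑ j, y j * ∑ n, A j n * x n‖ ≤ ∑ j, ‖y j‖ * ‖∑ n, A j n * x n‖ :=
    (norm_sum_le _ _).trans_eq (by simp_rw [norm_mul])
  calc _ ≤ (∑ j, ‖y j‖ * ‖∑ n, A j n * x n‖) ^ 2 := by gcongr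
    _ ≤ (∑ j, ‖y j‖ ^ 2) * ∑ j, ‖∑ n, A j n * x n‖ ^ 2 := Finset.sum_mul_sq_le_sq_mul_sq _ _ _
    _ ≤ 1 * (M * 1) := by
        gcongr
        exact (hA x).trans (by gcongr)
    _ = M := by ring

/-- Riesz–Thorin interpolation between `ℓ¹ → ℓ^∞` and `ℓ² → ℓ²`, in bilinear form. -/
lemma norm_bilin_le_rpow {ι κ : Type*} [Fintype ι] [Fintype κ] {A : κ → ι → ℂ} {M p q : ℝ}
    (hA₁ : ∀ j n, ‖A j n‖ ≤ 1)
    (hA₂ : ∀ x : ι → ℂ, ∑ j, ‖∑ n, A j n * x n‖ ^ 2 ≤ M * ∑ n, ‖x n‖ ^ 2) (hM : 0 ≤ M)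
    (hpq : p.HolderConjugate q) (hp : p ≤ 2) {y : κ → ℂ} {x : ι → ℂ}
    (hy : ∑ j, ‖y j‖ ^ p ≤ 1) (hx : ∑ n, ‖x n‖ ^ p ≤ 1) :
    ‖∑ j, y j * ∑ n, A j n * x n‖ ≤ M ^ (1 / q) := by
  have hp0 : 0 < p := hpq.pos
  have hq0 : 0 < q := hpq.symm.pos
  have hp1 : 1 < p := hpq.lt
  have hinv : 1 / p + 1 / q = 1 := by simpa using hpq.inv_add_inv_eq_one
  -- The exponent has real part `p` on `re z = 0` and `p / 2` on `re z = 1`, turning `ℓ^p`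
  -- normalization into `ℓ¹` and `ℓ²` normalization. It equals 1 at `z = 2 / q`, where `F` is the
  -- original form. Its real part stays positive on the strip, as `norm_signedPow` requires.
  set φ : ℂ → ℂ := fun z => p * (1 - z / 2) with hφ
  have hφre : ∀ z, (φ z).re = p * (1 - z.re / 2) := by
    intro z
    simp [hφ]
  set F : ℂ → ℂ := fun z =>
    ∑ j, signedPow (y j) (φ z) * ∑ n, A j n * signedPow (x n) (φ z) with hF
  have hFd : Differentiable ℂ F := by
    have h : ∀ c, Differentiable ℂ fun z => signedPow c (φ z) := fun c =>
      (differentiable_signedPow c).comp (by fun_prop)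
    fun_prop
  have hle : ∀ {c : ℂ} {z : ℂ}, ‖c‖ ≤ 1 → z.re ≤ 1 → ‖signedPow c (φ z)‖ ≤ 1 := by
    intro c z hc hz
    have : 0 < (φ z).re := by
      rw [hφre]
      exact mul_pos hp0 (by linarith)
    rw [norm_signedPow this]
    exact Real.rpow_le_one (norm_nonneg _) hc this.le
  have hbdd : BddAbove ((norm ∘ F) '' Complex.HadamardThreeLines.verticalClosedStrip 0 1) := by
    refine ⟨(∑ _j : κ, (1 : ℝ)) * ∑ _n : ι, (1 : ℝ), ?_⟩
    rintro _ ⟨z, hz, rfl⟩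
    refine (norm_bilin_le_mul_sum hA₁ _ _).trans ?_
    gcongr with j _ n _
    · exact hle (norm_le_one_of_sum_rpow_le_one hp0 hy j) hz.2
    · exact hle (norm_le_one_of_sum_rpow_le_one hp0 hx n) hz.2
  have h0 : ∀ z ∈ Complex.re ⁻¹' {0}, ‖F z‖ ≤ 1 := by
    intro z hz
    have hz' : z.re = 0 := hz
    have hre : (φ z).re = p := by rw [hφre, hz']; ring
    refine (norm_bilin_le_mul_sum hA₁ _ _).trans ?_
    simp_rw [norm_signedPow (hre ▸ hp0 : 0 < (φ z).re), hre]
    exact mul_le_one₀ hy (by positivity) hx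
  have h1 : ∀ z ∈ Complex.re ⁻¹' {1}, ‖F z‖ ≤ √M := by
    intro z hz
    have hz' : z.re = 1 := hz
    have hre : (φ z).re = p / 2 := by rw [hφre, hz']; ring
    have hsq : ∀ c, ‖signedPow c (φ z)‖ ^ 2 = ‖c‖ ^ p := by
      intro c
      rw [norm_signedPow (by rw [hre]; positivity), hre, ← Real.rpow_natCast,
        ← Real.rpow_mul (norm_nonneg _)]
      congr 1
      push_cast
      ring
    refine norm_bilin_le_sqrt hA₂ hM ?_ ?_
    · simpa only [hsq] using hy
    · simpa only [hsq] using hx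
  have hθ : φ (2 / q : ℝ) = 1 := by
    have : p * (1 - (2 / q) / 2) = 1 := by
      have h2 : (2 / q) / 2 = 1 / q := by ring
      have h3 : 1 - 1 / q = 1 / p := by linarith
      rw [h2, h3, mul_one_div_cancel hp0.ne']
    simp only [hφ]
    exact_mod_cast congrArg (fun r : ℝ => (r : ℂ)) this
  have hq2 : 2 / q ≤ 1 := by
    have : 1 / 2 ≤ 1 / p := one_div_le_one_div_of_le hp0 hp
    have h2 : 2 / q = 2 * (1 / q) := by ring
    linarith
  have key := Complex.HadamardThreeLines.norm_le_interp_of_mem_verticalClosedStrip₀₁' F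
    (z := ((2 / q : ℝ) : ℂ)) (a := 1) (b := √M)
    ⟨by rw [Complex.ofReal_re]; positivity, by rwa [Complex.ofReal_re]⟩
    hFd.diffContOnCl hbdd h0 h1
  rw [Complex.ofReal_re, Real.one_rpow, one_mul, Real.sqrt_eq_rpow, ← Real.rpow_mul hM,
    show 1 / 2 * (2 / q) = 1 / q by ring] at key
  simpa only [hF, hθ, signedPow_one] using key

/-- The equality case of Hölder's inequality: take the nonnegative extremal for the moduli and
multiply by the conjugate phases of `b`. -/
lemma exists_dual_vector {κ : Type*} [Fintype κ] {p q : ℝ} (hpq : p.HolderConjugate q)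
    (b : κ → ℂ) :
    ∃ y : κ → ℂ, ∑ j, ‖y j‖ ^ p ≤ 1 ∧ ‖∑ j, y j * b j‖ = (∑ j, ‖b j‖ ^ q) ^ (1 / q) := by
  obtain ⟨g, hg, hgb⟩ := (NNReal.isGreatest_Lp Finset.univ (fun j => ‖b j‖₊) hpq.symm).1
  refine ⟨fun j => g j * (starRingEnd ℂ (b j) / ‖b j‖), ?_, ?_⟩
  · have hg' : ∑ j, (g j : ℝ) ^ p ≤ 1 := by exact_mod_cast hg
    refine (Finset.sum_le_sum fun j _ => ?_).trans hg'
    · refine Real.rpow_le_rpow (norm_nonneg _) ?_ hpq.nonneg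
      rw [norm_mul, norm_div, RCLike.norm_conj, Complex.norm_real, Complex.norm_real, norm_norm]
      refine (mul_le_of_le_one_right (norm_nonneg _) (div_self_le_one _)).trans_eq ?_
      simp
  · have h : ∀ j, (g j : ℂ) * (starRingEnd ℂ (b j) / ‖b j‖) * b j = ((‖b j‖ * g j : ℝ) : ℂ) := by
      intro j
      rcases eq_or_ne (b j) 0 with h | h
      · simp [h]
      · have hc : (‖b j‖ : ℂ) ≠ 0 := by simpa using h
        have := Complex.conj_mul' (b j)
        field_simp
        push_cast
        linear_combination (g j : ℂ) * this
    simp_rw [h]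
    rw [← Complex.ofReal_sum, Complex.norm_real, Real.norm_of_nonneg
      (Finset.sum_nonneg fun j _ => by positivity)]
    have := congrArg (fun r : NNReal => (r : ℝ)) hgb
    simpa using this

/-- A finite matrix with entries of modulus at most `1` and with `ℓ² → ℓ²` norm at most `√M` has
`ℓ^p → ℓ^q` norm at most `M ^ (1 / q)` for conjugate exponents `p ≤ 2 ≤ q`. -/
lemma sum_rpow_le_of_conjugate {ι κ : Type*} [Fintype ι] [Fintype κ] {A : κ → ι → ℂ} {M p q : ℝ}
    (hA₁ : ∀ j n, ‖A j n‖ ≤ 1)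
    (hA₂ : ∀ x : ι → ℂ, ∑ j, ‖∑ n, A j n * x n‖ ^ 2 ≤ M * ∑ n, ‖x n‖ ^ 2) (hM : 0 ≤ M)
    (hpq : p.HolderConjugate q) (hp : p ≤ 2) (x : ι → ℂ) :
    ∑ j, ‖∑ n, A j n * x n‖ ^ q ≤ M * ((∑ n, ‖x n‖ ^ p) ^ (1 / p)) ^ q := by
  have hp0 : 0 < p := hpq.pos
  have hq0 : 0 < q := hpq.symm.pos
  set S := ∑ n, ‖x n‖ ^ p with hS
  have hS0 : 0 ≤ S := Finset.sum_nonneg fun n _ => by positivity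
  rcases hS0.eq_or_lt with h | h
  · have hx : ∀ n, x n = 0 := by
      intro n
      have := (Finset.sum_eq_zero_iff_of_nonneg (fun n _ => by positivity)).mp (hS ▸ h.symm) n
        (Finset.mem_univ n)
      simpa using (Real.rpow_eq_zero (norm_nonneg _) hp0.ne').mp this
    simp only [hx, mul_zero, Finset.sum_const_zero, norm_zero, Real.zero_rpow hq0.ne']
    positivity
  · set s : ℝ := S ^ (1 / p) with hs
    have hs0 : 0 < s := Real.rpow_pos_of_pos h _
    have hsp : s ^ p = S := by
      rw [hs, ← Real.rpow_mul hS0, one_div_mul_cancel hp0.ne', Real.rpow_one]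
    set b : κ → ℂ := fun j => ∑ n, A j n * x n
    obtain ⟨y, hy, hyb⟩ := exists_dual_vector hpq b
    -- The bilinear bound is for unit vectors, so `x` is divided by its `ℓ^p` norm `s`.
    have hx' : ∑ n, ‖x n / s‖ ^ p ≤ 1 := by
      simp_rw [norm_div, Complex.norm_real, Real.norm_of_nonneg hs0.le,
        Real.div_rpow (norm_nonneg _) hs0.le, hsp]
      rw [← Finset.sum_div, ← hS, div_self h.ne']
    have key := norm_bilin_le_rpow hA₁ hA₂ hM hpq hp hy hx'
    have hlin : ∑ j, y j * ∑ n, A j n * (x n / s) = (∑ j, y j * b j) / s := by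
      simp_rw [b, ← mul_div_assoc, ← Finset.sum_div, ← mul_div_assoc, ← Finset.sum_div]
    rw [hlin, norm_div, hyb, Complex.norm_real, Real.norm_of_nonneg hs0.le, div_le_iff₀ hs0] at key
    have h2 := Real.rpow_le_rpow (by positivity) key hq0.le
    rwa [Real.mul_rpow (by positivity) hs0.le, ← Real.rpow_mul (by positivity),
      ← Real.rpow_mul hM, one_div_mul_cancel hq0.ne', Real.rpow_one, Real.rpow_one] at h2

/-! ### The discrete Fourier transform -/

lemma sum_pow_root_of_unity_mul_conj {N : ℕ} (hN : N ≠ 0) (n m : Fin N) :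
    ∑ j : Fin N, Complex.exp (Complex.I * (n : ℕ) * ((2 * Real.pi * (j : ℕ) / N : ℝ) : ℂ)) *
      starRingEnd ℂ (Complex.exp (Complex.I * (m : ℕ) * ((2 * Real.pi * (j : ℕ) / N : ℝ) : ℂ))) =
      if n = m then (N : ℂ) else 0 := by
  have hN' : (N : ℂ) ≠ 0 := Nat.cast_ne_zero.mpr hN
  set ζ : ℂ := Complex.exp (2 * Real.pi * Complex.I / N) with hζ
  have hprim : IsPrimitiveRoot ζ N := Complex.isPrimitiveRoot_exp N hN
  have hζ0 : ζ ≠ 0 := Complex.exp_ne_zero _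
  have hterm : ∀ j : Fin N,
      Complex.exp (Complex.I * (n : ℕ) * ((2 * Real.pi * (j : ℕ) / N : ℝ) : ℂ)) *
      starRingEnd ℂ (Complex.exp (Complex.I * (m : ℕ) * ((2 * Real.pi * (j : ℕ) / N : ℝ) : ℂ))) =
      (ζ ^ (n : ℕ) / ζ ^ (m : ℕ)) ^ (j : ℕ) := by
    intro j
    rw [← Complex.exp_conj, hζ, ← Complex.exp_nat_mul, ← Complex.exp_nat_mul, ← Complex.exp_sub,
      ← Complex.exp_nat_mul, ← Complex.exp_add]
    congr 1
    simp only [map_mul, Complex.conj_I, Complex.conj_ofReal, map_natCast]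
    push_cast
    field_simp
    ring
  simp_rw [hterm]
  rw [Fin.sum_univ_eq_sum_range (fun j => (ζ ^ (n : ℕ) / ζ ^ (m : ℕ)) ^ j)]
  split_ifs with h
  · simp [h, div_self (pow_ne_zero _ hζ0)]
  · have hne : ζ ^ (n : ℕ) / ζ ^ (m : ℕ) ≠ 1 := by
      intro h1
      exact h (Fin.ext (hprim.pow_inj n.2 m.2 ((div_eq_one_iff_eq (pow_ne_zero _ hζ0)).mp h1)))
    have hpow : (ζ ^ (n : ℕ) / ζ ^ (m : ℕ)) ^ N = 1 := by
      rw [div_pow, ← pow_mul, ← pow_mul, mul_comm, pow_mul, mul_comm (m : ℕ), pow_mul,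
        hprim.pow_eq_one]
      simp
    rw [geom_sum_eq hne, hpow, sub_self, zero_div]

/-- Parseval's identity for the discrete Fourier transform. -/
lemma sum_norm_sq_dft {N : ℕ} (hN : N ≠ 0) (x : Fin N → ℂ) :
    ∑ j : Fin N, ‖∑ n : Fin N,
      Complex.exp (Complex.I * (n : ℕ) * ((2 * Real.pi * (j : ℕ) / N : ℝ) : ℂ)) * x n‖ ^ 2 =
      N * ∑ n, ‖x n‖ ^ 2 := by
  set A : Fin N → Fin N → ℂ := fun j n =>
    Complex.exp (Complex.I * (n : ℕ) * ((2 * Real.pi * (j : ℕ) / N : ℝ) : ℂ)) with hA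
  have horth : ∀ n m, ∑ j, A j n * starRingEnd ℂ (A j m) = if n = m then (N : ℂ) else 0 :=
    sum_pow_root_of_unity_mul_conj hN
  have hcast : ∀ z : ℂ, ((‖z‖ ^ 2 : ℝ) : ℂ) = z * starRingEnd ℂ z := by
    intro z
    rw [Complex.mul_conj']
    push_cast
    rfl
  have : ((∑ j, ‖∑ n, A j n * x n‖ ^ 2 : ℝ) : ℂ) = ((N * ∑ n, ‖x n‖ ^ 2 : ℝ) : ℂ) := by
    rw [Complex.ofReal_sum, Complex.ofReal_mul, Complex.ofReal_sum]
    simp_rw [hcast, map_sum, Finset.sum_mul_sum, map_mul]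
    rw [Finset.sum_comm, Finset.mul_sum]
    refine Finset.sum_congr rfl fun n _ => ?_
    rw [Finset.sum_comm]
    have : ∀ m, ∑ j, A j n * x n * (starRingEnd ℂ (A j m) * starRingEnd ℂ (x m)) =
        (if n = m then (N : ℂ) else 0) * (x n * starRingEnd ℂ (x m)) := by
      intro m
      rw [← horth, Finset.sum_mul]
      exact Finset.sum_congr rfl fun j _ => by ring
    simp_rw [this, ite_mul, zero_mul]
    simp
  exact_mod_cast this

/-! ### Trigonometric sums and the circle measure -/

lemma norm_exp_I_mul (n : ℕ) (t : ℝ) : ‖Complex.exp (Complex.I * (n : ℂ) * (t : ℂ))‖ = 1 := by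
  rw [show Complex.I * (n : ℂ) * (t : ℂ) = Complex.I * ((n * t : ℝ) : ℂ) by push_cast; ring]
  exact Complex.norm_exp_I_mul_ofReal _

lemma continuous_T (N : ℕ) (a : Fin N → ℂ) : Continuous (T N a) := by
  unfold T
  fun_prop

lemma periodic_T (N : ℕ) (a : Fin N → ℂ) : Function.Periodic (T N a) (2 * Real.pi) := by
  intro t
  unfold T
  refine Finset.sum_congr rfl fun n _ => ?_
  congr 1
  rw [Complex.exp_eq_exp_iff_exists_int]
  exact ⟨n, by push_cast; ring⟩

lemma norm_T_le (N : ℕ) (a : Fin N → ℂ) (t : ℝ) : ‖T N a t‖ ≤ ∑ n, ‖a n‖ :=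
  (norm_sum_le _ _).trans_eq (by simp_rw [norm_mul, norm_exp_I_mul, mul_one])

/-- The values of `T N a` at the translates of `t` by `N`-th parts of the period are a discrete
Fourier transform. -/
lemma T_add (N : ℕ) (a : Fin N → ℂ) (t s : ℝ) :
    T N a (t + s) = ∑ n : Fin N, Complex.exp (Complex.I * (n : ℕ) * (s : ℂ)) *
      (a n * Complex.exp (Complex.I * (n : ℕ) * (t : ℂ))) := by
  unfold T
  refine Finset.sum_congr rfl fun n _ => ?_
  rw [Complex.ofReal_add, mul_add, Complex.exp_add]
  ring

lemma circleMeasure_eq (s : Set ℝ) (hs : MeasurableSet s) :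
    circleMeasure s =
      (ENNReal.ofReal (2 * Real.pi))⁻¹ * volume (s ∩ Set.Ioo (-Real.pi) Real.pi) := by
  simp [circleMeasure, Measure.restrict_apply hs]

instance : IsProbabilityMeasure circleMeasure := by
  constructor
  rw [circleMeasure_eq _ MeasurableSet.univ, Set.univ_inter, Real.volume_Ioo,
    show Real.pi - -Real.pi = 2 * Real.pi by ring]
  exact ENNReal.inv_mul_cancel (by simpa using Real.pi_pos) ENNReal.ofReal_ne_top

lemma integral_circleMeasure (g : ℝ → ℝ) :
    ∫ t, g t ∂circleMeasure = (2 * Real.pi)⁻¹ * ∫ t in -Real.pi..Real.pi, g t := by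
  rw [circleMeasure, integral_smul_measure,
    intervalIntegral.integral_of_le (by linarith [Real.pi_pos]), integral_Ioc_eq_integral_Ioo,
    ENNReal.toReal_inv, ENNReal.toReal_ofReal (by positivity), smul_eq_mul]

lemma integrable_circleMeasure {g : ℝ → ℝ} (hg : Continuous g) : Integrable g circleMeasure := by
  refine Integrable.smul_measure ?_ (by simpa using Real.pi_pos)
  exact (hg.integrableOn_Icc (a := -Real.pi) (b := Real.pi)).mono_set Set.Ioo_subset_Icc_self

lemma integral_circleMeasure_add {g : ℝ → ℝ} (hg : Function.Periodic g (2 * Real.pi)) (s : ℝ) :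
    ∫ t, g (t + s) ∂circleMeasure = ∫ t, g t ∂circleMeasure := by
  rw [integral_circleMeasure, integral_circleMeasure, intervalIntegral.integral_comp_add_right]
  congr 1
  have := hg.intervalIntegral_add_eq (-Real.pi + s) (-Real.pi)
  rwa [show -Real.pi + s + 2 * Real.pi = Real.pi + s by ring,
    show -Real.pi + 2 * Real.pi = Real.pi by ring] at this

/-- Transfers inequalities for `N` samples, uniform in the base point, to integrals over the circle.
-/
lemma integral_sum_translates {g : ℝ → ℝ} (hc : Continuous g)
    (hg : Function.Periodic g (2 * Real.pi)) (N : ℕ) (s : Fin N → ℝ) :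
    ∫ t, ∑ j, g (t + s j) ∂circleMeasure = N * ∫ t, g t ∂circleMeasure := by
  rw [integral_finsetSum _ fun j _ => integrable_circleMeasure (by fun_prop)]
  simp [integral_circleMeasure_add hg]

/-! ### Parseval and Hausdorff–Young -/

lemma integral_norm_sq_T {N : ℕ} (hN : N ≠ 0) (a : Fin N → ℂ) :
    ∫ t, ‖T N a t‖ ^ 2 ∂circleMeasure = ∑ n, ‖a n‖ ^ 2 := by
  have hN' : (N : ℝ) ≠ 0 := Nat.cast_ne_zero.mpr hN
  refine mul_left_cancel₀ hN' ?_
  rw [← integral_sum_translates (g := fun t => ‖T N a t‖ ^ 2) ((continuous_T N a).norm.pow 2)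
    (fun t => by simp only [periodic_T N a t]) N fun j => 2 * Real.pi * (j : ℕ) / N]
  simp_rw [T_add, sum_norm_sq_dft hN, norm_mul, norm_exp_I_mul, mul_one]
  simp

lemma integral_norm_rpow_T_le {N : ℕ} (hN : N ≠ 0) (a : Fin N → ℂ) {p q : ℝ}
    (hpq : p.HolderConjugate q) (hp : p ≤ 2) :
    ∫ t, ‖T N a t‖ ^ q ∂circleMeasure ≤ ((∑ n, ‖a n‖ ^ p) ^ (1 / p)) ^ q := by
  have hN' : (0 : ℝ) < N := Nat.cast_pos.mpr (Nat.pos_of_ne_zero hN)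
  have hc : Continuous fun t => ‖T N a t‖ ^ q :=
    (continuous_T N a).norm.rpow_const fun _ => Or.inr hpq.symm.nonneg
  refine le_of_mul_le_mul_left ?_ hN'
  rw [← integral_sum_translates hc
    (fun t => by simp only [periodic_T N a t]) N fun j => 2 * Real.pi * (j : ℕ) / N]
  -- For fixed `t` the samples are the DFT of `a n * e^{int}`, which has the same moduli as `a`.
  have hpt : ∀ t, ∑ j : Fin N, ‖T N a (t + 2 * Real.pi * (j : ℕ) / N)‖ ^ q ≤
      N * ((∑ n, ‖a n‖ ^ p) ^ (1 / p)) ^ q := by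
    intro t
    have := sum_rpow_le_of_conjugate (A := fun j n : Fin N =>
        Complex.exp (Complex.I * (n : ℕ) * ((2 * Real.pi * (j : ℕ) / N : ℝ) : ℂ)))
      (fun j n => (norm_exp_I_mul n _).le) (fun x => (sum_norm_sq_dft hN x).le) hN'.le hpq hp
      (fun n => a n * Complex.exp (Complex.I * (n : ℕ) * (t : ℂ)))
    simp_rw [norm_mul, norm_exp_I_mul, mul_one] at this
    simpa only [T_add] using this
  refine (integral_mono (integrable_circleMeasure ?_) (integrable_const _) hpt).trans_eq (by simp)
  exact continuous_finsetSum _ fun j _ => hc.comp (continuous_add_const _)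

lemma memLp_T (N : ℕ) (a : Fin N → ℂ) (q : ℝ≥0∞) : MemLp (T N a) q circleMeasure :=
  MemLp.of_bound (continuous_T N a).aestronglyMeasurable (∑ n, ‖a n‖)
    (ae_of_all _ (norm_T_le N a))

/-- The Hausdorff–Young inequality for trigonometric sums. -/
lemma eLpNorm_T_le {N : ℕ} (hN : N ≠ 0) (a : Fin N → ℂ) {p q : ℝ≥0∞} (hp1 : 1 ≤ p) (hp2 : p ≤ 2)
    (hpq : p⁻¹ + q⁻¹ = 1) :
    eLpNorm (T N a) q circleMeasure ≤ ENNReal.ofReal ‖WithLp.toLp p a‖ := by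
  have hptop : p ≠ ∞ := ne_top_of_le_ne_top (by simp) hp2
  have hp0 : p ≠ 0 := (zero_lt_one.trans_le hp1).ne'
  rcases hp1.eq_or_lt with rfl | hp1
  · have hq : q = ∞ := by
      rw [inv_one] at hpq
      exact ENNReal.inv_eq_zero.mp ((ENNReal.add_right_inj ENNReal.one_ne_top).mp
        (hpq.trans (add_zero 1).symm))
    rw [hq, eLpNorm_exponent_top, PiLp.norm_eq_of_L1]
    exact eLpNormEssSup_le_of_ae_bound (ae_of_all _ (norm_T_le N a))
  · have hpR : 1 < p.toReal := by
      rw [← ENNReal.toReal_one]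
      exact (ENNReal.toReal_lt_toReal ENNReal.one_ne_top hptop).mpr hp1
    have hqtop : q ≠ ∞ := by
      rintro rfl
      rw [ENNReal.inv_top, add_zero, ENNReal.inv_eq_one] at hpq
      exact hp1.ne' hpq
    have hq0 : q ≠ 0 := by
      rintro rfl
      simp at hpq
    have hconj : p.toReal.HolderConjugate q.toReal := by
      rw [Real.holderConjugate_iff]
      refine ⟨hpR, ?_⟩
      rw [← ENNReal.toReal_inv, ← ENNReal.toReal_inv, ← ENNReal.toReal_add
        (ENNReal.inv_ne_top.mpr hp0) (ENNReal.inv_ne_top.mpr hq0), hpq, ENNReal.toReal_one]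
    have hp2' : p.toReal ≤ 2 := by
      simpa using ENNReal.toReal_mono (by simp) hp2
    rw [(memLp_T N a q).eLpNorm_eq_integral_rpow_norm hq0 hqtop]
    refine ENNReal.ofReal_le_ofReal ?_
    rw [PiLp.norm_eq_sum (by linarith), Real.rpow_inv_le_iff_of_pos
      (integral_nonneg fun t => by positivity) (by positivity) hconj.symm.pos]
    exact integral_norm_rpow_T_le hN a hconj hp2'

/-! ### Norms on `ℂ^N` via counting measure -/

lemma ofReal_norm_toLp_eq_eLpNorm_count {N : ℕ} (a : Fin N → ℂ) {p : ℝ≥0∞} (hp : 1 ≤ p) :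
    ENNReal.ofReal ‖WithLp.toLp p a‖ = eLpNorm a p Measure.count := by
  have hp0 : p ≠ 0 := (zero_lt_one.trans_le hp).ne'
  have : Fact (1 ≤ p) := ⟨hp⟩
  rw [ofReal_norm]
  rcases eq_or_ne p ∞ with rfl | hptop
  · rw [eLpNorm_exponent_top, eLpNormEssSup_count, enorm_eq_nnnorm, PiLp.nnnorm_eq_ciSup,
      ENNReal.coe_iSup (Finite.bddAbove_range _)]
    rfl
  · rw [eLpNorm_eq_lintegral_rpow_enorm_toReal hp0 hptop, lintegral_count, tsum_fintype,
      enorm_eq_nnnorm, PiLp.nnnorm_eq_sum hptop,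
      ENNReal.coe_rpow_of_nonneg _ (by positivity), ENNReal.ofNNReal_finsetSum]
    simp_rw [ENNReal.coe_rpow_of_nonneg _ ENNReal.toReal_nonneg]
    rfl

lemma count_univ_fin (N : ℕ) : (Measure.count : Measure (Fin N)) Set.univ = N := by
  simp [Measure.count_apply_finite _ Set.finite_univ]

/-- Comparison of `ℓ^p` norms on `ℂ^N`. -/
lemma ofReal_norm_toLp_le {N : ℕ} (a : Fin N → ℂ) {r p : ℝ≥0∞} (hr : 1 ≤ r) (hrp : r ≤ p) :
    ENNReal.ofReal ‖WithLp.toLp r a‖ ≤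
      (N : ℝ≥0∞) ^ (r⁻¹.toReal - p⁻¹.toReal) * ENNReal.ofReal ‖WithLp.toLp p a‖ := by
  rw [ofReal_norm_toLp_eq_eLpNorm_count a hr, ofReal_norm_toLp_eq_eLpNorm_count a (hr.trans hrp),
    mul_comm]
  have := eLpNorm_le_eLpNorm_mul_rpow_measure_univ (μ := (Measure.count : Measure (Fin N))) hrp
    (f := a) (measurable_of_finite a).aestronglyMeasurable
  rwa [count_univ_fin, one_div, one_div, ← ENNReal.toReal_inv, ← ENNReal.toReal_inv] at this

/-- The `ℓ^p` norm of a vector which is unimodular in the first `K` coordinates and vanishes in the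
others. -/
lemma ofReal_norm_toLp_unimodular {N K : ℕ} (hK : K ≠ 0) (hKN : K ≤ N) (a : ℕ → ℂ)
    (ha : ∀ n < K, ‖a n‖ = 1) {p : ℝ≥0∞} (hp : 1 ≤ p) :
    ENNReal.ofReal ‖WithLp.toLp p fun n : Fin N => if (n : ℕ) < K then a n else 0‖ =
      (K : ℝ≥0∞) ^ p⁻¹.toReal := by
  have hp0 : p ≠ 0 := (zero_lt_one.trans_le hp).ne'
  set S : Set (Fin N) := {n | (n : ℕ) < K} with hS
  have hcount : (Measure.count : Measure (Fin N)) S = K := by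
    rw [Measure.count_apply_finite _ (Set.toFinite _)]
    congr 1
    rw [← Set.ncard_eq_toFinset_card, ← Nat.card_coe_set_eq]
    refine (Nat.card_congr
      { toFun := fun n => (⟨n.1, n.2⟩ : Fin K)
        invFun := fun k => ⟨⟨k, k.2.trans_le hKN⟩, k.2⟩
        left_inv := fun _ => rfl
        right_inv := fun _ => rfl }).trans (Nat.card_fin K)
  rw [ofReal_norm_toLp_eq_eLpNorm_count _ hp]
  have hnorm : eLpNorm (fun n : Fin N => if (n : ℕ) < K then a n else 0) p Measure.count =
      eLpNorm (S.indicator fun _ => (1 : ℂ)) p Measure.count := by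
    refine eLpNorm_congr_norm_ae (ae_of_all _ fun n => ?_)
    by_cases h : (n : ℕ) < K
    · simp [hS, h, ha _ h]
    · simp [hS, h]
  rw [hnorm, eLpNorm_indicator_const' (Set.toFinite _).measurableSet
    (by rw [hcount]; exact_mod_cast hK) hp0, hcount, one_div, ← ENNReal.toReal_inv]
  simp

/-! ### Bounding the best constant, with test vectors -/

lemma C_le {N : ℕ} {p q K : ℝ≥0∞} (h : ∀ a : Fin N → ℂ, eLpNorm (T N a) q circleMeasure ≤
    K * ENNReal.ofReal ‖WithLp.toLp p a‖) : C N p q ≤ K :=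
  iSup₂_le fun a _ => ENNReal.div_le_of_le_mul (h a)

lemma le_C {N : ℕ} {p q K : ℝ≥0∞} (a : Fin N → ℂ)
    (ha : ENNReal.ofReal ‖WithLp.toLp p a‖ ≠ 0) (ha' : a ≠ 0)
    (h : K * ENNReal.ofReal ‖WithLp.toLp p a‖ ≤ eLpNorm (T N a) q circleMeasure) : K ≤ C N p q :=
  le_iSup₂_of_le a ha'
    ((ENNReal.le_div_iff_mul_le (Or.inl ha) (Or.inl ENNReal.ofReal_ne_top)).mpr h)

lemma le_C_of_unimodular {N K : ℕ} (hK : K ≠ 0) (hKN : K ≤ N) (a : ℕ → ℂ)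
    (ha : ∀ n < K, ‖a n‖ = 1) {p q : ℝ≥0∞} (hp : 1 ≤ p) {c : ℝ≥0∞}
    (h : c * (K : ℝ≥0∞) ^ p⁻¹.toReal ≤
      eLpNorm (fun t : ℝ => ∑ n ∈ Finset.range K, a n * Complex.exp (Complex.I * n * t)) q
        circleMeasure) : c ≤ C N p q := by
  have hnorm := ofReal_norm_toLp_unimodular hK hKN a ha hp
  have hT : T N (fun n : Fin N => if (n : ℕ) < K then a n else 0) =
      fun t : ℝ => ∑ n ∈ Finset.range K, a n * Complex.exp (Complex.I * n * t) := by
    ext t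
    unfold T
    rw [Fin.sum_univ_eq_sum_range
      (fun n => (if n < K then a n else 0) * Complex.exp (Complex.I * n * t)) N]
    simp_rw [ite_mul, zero_mul]
    rw [← Finset.sum_filter]
    congr 1
    ext n
    simp only [Finset.mem_filter, Finset.mem_range]
    omega
  refine le_C (fun n : Fin N => if (n : ℕ) < K then a n else 0) ?_ ?_ ?_
  · rw [hnorm]
    simp [hK]
  · intro h0
    have := congrFun h0 ⟨0, by omega⟩
    have h1 := ha 0 (Nat.pos_of_ne_zero hK)
    simp only [Nat.pos_of_ne_zero hK, if_true, Pi.zero_apply] at this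
    simp [this] at h1
  · rwa [hnorm, hT]

/-! ### The Dirichlet kernel -/

lemma two_div_pi_mul_le_norm_dirichlet {N : ℕ} (hN : N ≠ 0) {t : ℝ} (ht : |t| ≤ Real.pi / N) :
    2 / Real.pi * N ≤ ‖∑ n ∈ Finset.range N, Complex.exp (Complex.I * n * t)‖ := by
  have hN' : (0 : ℝ) < N := Nat.cast_pos.mpr (Nat.pos_of_ne_zero hN)
  have hpi := Real.pi_pos
  rcases eq_or_ne t 0 with rfl | ht0
  · simp only [Complex.ofReal_zero, mul_zero, Complex.exp_zero, Finset.sum_const,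
      Finset.card_range, nsmul_eq_mul, mul_one, Complex.norm_natCast]
    refine mul_le_of_le_one_left hN'.le ?_
    rw [div_le_one hpi]
    exact Real.two_le_pi
  · have habs : 0 < |t| := abs_pos.mpr ht0
    set w : ℂ := Complex.exp (Complex.I * t) with hw
    have hgeom : (∑ n ∈ Finset.range N, Complex.exp (Complex.I * n * t)) * (w - 1) =
        Complex.exp (Complex.I * ((N * t : ℝ) : ℂ)) - 1 := by
      have : ∀ n : ℕ, Complex.exp (Complex.I * n * t) = w ^ n := by
        intro n
        rw [hw, ← Complex.exp_nat_mul]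
        congr 1
        ring
      simp_rw [this]
      rw [geom_sum_mul, hw, ← Complex.exp_nat_mul]
      congr 2
      push_cast
      ring
    have h1 := congrArg norm hgeom
    rw [norm_mul, Complex.norm_exp_I_mul_ofReal_sub_one (N * t)] at h1
    have h2 : ‖w - 1‖ ≤ |t| := Real.norm_exp_I_mul_ofReal_sub_one_le
    -- Jordan's inequality `sin x ≥ 2x/π` on `[0, π/2]` is the source of the constant `2/π`.
    have h3 : 2 / Real.pi * (N * |t|) ≤ ‖2 * Real.sin (N * t / 2)‖ := by
      have hx : N * |t| / 2 ≤ Real.pi / 2 := by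
        rw [le_div_iff₀ hN'] at ht
        linarith
      have hs := Real.mul_le_sin (by positivity) hx
      have hsin : |Real.sin (N * t / 2)| = |Real.sin (N * |t| / 2)| := by
        rcases abs_choice t with h | h
        · rw [h]
        · rw [h, show (N : ℝ) * -t / 2 = -(N * t / 2) by ring, Real.sin_neg, abs_neg]
      rw [Real.norm_eq_abs, abs_mul, abs_two, hsin]
      have := le_abs_self (Real.sin (N * |t| / 2))
      linarith
    have h4 : 2 / Real.pi * N * |t| ≤
        ‖∑ n ∈ Finset.range N, Complex.exp (Complex.I * n * t)‖ * |t| := by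
      calc _ = 2 / Real.pi * (N * |t|) := by ring
        _ ≤ _ := h3
        _ = _ := h1.symm
        _ ≤ _ := by gcongr
    exact le_of_mul_le_mul_right h4 habs

lemma circleMeasure_Ioo {N : ℕ} (hN : N ≠ 0) :
    circleMeasure (Set.Ioo (-(Real.pi / N)) (Real.pi / N)) = (N : ℝ≥0∞)⁻¹ := by
  have hN' : (1 : ℝ) ≤ N := Nat.one_le_cast.mpr (Nat.pos_of_ne_zero hN)
  have hle : Real.pi / N ≤ Real.pi := div_le_self Real.pi_pos.le hN'
  rw [circleMeasure_eq _ measurableSet_Ioo,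
    Set.inter_eq_left.mpr (Set.Ioo_subset_Ioo (neg_le_neg hle) hle), Real.volume_Ioo,
    show Real.pi / N - -(Real.pi / N) = 2 * Real.pi * (N : ℝ)⁻¹ by ring,
    ENNReal.ofReal_mul (p := 2 * Real.pi) (by positivity), ← mul_assoc, ENNReal.inv_mul_cancel
      (by simpa using Real.pi_pos) ENNReal.ofReal_ne_top, one_mul,
    ENNReal.ofReal_inv_of_pos (by linarith), ENNReal.ofReal_natCast]

lemma le_eLpNorm_dirichlet {N : ℕ} (hN : N ≠ 0) {q : ℝ≥0∞} (hq : q ≠ 0) :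
    ENNReal.ofReal (2 / Real.pi * N) * ((N : ℝ≥0∞)⁻¹) ^ q⁻¹.toReal ≤
      eLpNorm (fun t : ℝ => ∑ n ∈ Finset.range N, Complex.exp (Complex.I * n * t)) q
        circleMeasure := by
  set S := Set.Ioo (-(Real.pi / N)) (Real.pi / N)
  have hμ : circleMeasure S = (N : ℝ≥0∞)⁻¹ := circleMeasure_Ioo hN
  have h := eLpNorm_indicator_const' (μ := circleMeasure) (p := q) (c := 2 / Real.pi * (N : ℝ))
    (s := S) measurableSet_Ioo (by rw [hμ]; simp) hq
  rw [hμ, one_div, ← ENNReal.toReal_inv, Real.enorm_of_nonneg (by positivity)] at h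
  rw [← h]
  refine eLpNorm_mono fun t => ?_
  by_cases ht : t ∈ S
  · rw [Set.indicator_of_mem ht, Real.norm_of_nonneg (by positivity)]
    exact two_div_pi_mul_le_norm_dirichlet hN (abs_le.mpr ⟨ht.1.le, ht.2.le⟩)
  · rw [Set.indicator_of_notMem ht, norm_zero]
    exact norm_nonneg _

/-! ### Rudin–Shapiro polynomials -/

/-- The Rudin–Shapiro construction. -/
lemma exists_rudinShapiro (k : ℕ) : ∃ a b : ℕ → ℂ,
    (∀ n < 2 ^ k, ‖a n‖ = 1) ∧ (∀ n < 2 ^ k, ‖b n‖ = 1) ∧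
    ∀ t : ℝ, ‖∑ n ∈ Finset.range (2 ^ k), a n * Complex.exp (Complex.I * n * t)‖ ^ 2 +
      ‖∑ n ∈ Finset.range (2 ^ k), b n * Complex.exp (Complex.I * n * t)‖ ^ 2 = 2 * 2 ^ k := by
  induction k with
  | zero => exact ⟨fun _ => 1, fun _ => 1, by simp, by simp, fun t => by norm_num⟩
  | succ k ih =>
    obtain ⟨a, b, ha, hb, hab⟩ := ih
    have hsum : ∀ (c d : ℕ → ℂ) (t : ℝ),
        ∑ n ∈ Finset.range (2 ^ (k + 1)), (if n < 2 ^ k then c n else d (n - 2 ^ k)) *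
          Complex.exp (Complex.I * n * t) =
        ∑ n ∈ Finset.range (2 ^ k), c n * Complex.exp (Complex.I * n * t) +
          Complex.exp (Complex.I * (2 ^ k : ℕ) * t) *
          ∑ n ∈ Finset.range (2 ^ k), d n * Complex.exp (Complex.I * n * t) := by
      intro c d t
      rw [pow_succ, mul_two, Finset.sum_range_add, Finset.mul_sum]
      congr 1
      · refine Finset.sum_congr rfl fun n hn => ?_
        rw [if_pos (Finset.mem_range.mp hn)]
      · refine Finset.sum_congr rfl fun n _ => ?_
        rw [if_neg (by omega), Nat.add_sub_cancel_left, Nat.cast_add, mul_add, add_mul,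
          Complex.exp_add]
        ring
    refine ⟨fun n => if n < 2 ^ k then a n else b (n - 2 ^ k),
      fun n => if n < 2 ^ k then a n else -b (n - 2 ^ k), fun n hn => ?_, fun n hn => ?_,
      fun t => ?_⟩
    · dsimp only
      split_ifs with h
      · exact ha n h
      · exact hb _ (by rw [pow_succ] at hn; omega)
    · dsimp only
      split_ifs with h
      · exact ha n h
      · rw [norm_neg]
        exact hb _ (by rw [pow_succ] at hn; omega)
    · rw [hsum a b t, hsum a (fun n => -b n) t]
      simp_rw [neg_mul, Finset.sum_neg_distrib, mul_neg, ← sub_eq_add_neg]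
      -- The new pair is `P ± e^{i 2^k t} Q`, so the parallelogram law doubles `|P|² + |Q|²`.
      have := parallelogram_law_with_norm ℝ
        (∑ n ∈ Finset.range (2 ^ k), a n * Complex.exp (Complex.I * n * t))
        (Complex.exp (Complex.I * (2 ^ k : ℕ) * t) *
          ∑ n ∈ Finset.range (2 ^ k), b n * Complex.exp (Complex.I * n * t))
      simp only [norm_mul, norm_exp_I_mul, one_mul] at this
      have h2 := hab t
      rw [pow_succ (2 : ℝ) k]
      linarith

/-- There is a trigonometric sum with `2 ^ k` unimodular coefficients and large `L¹` norm. -/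
lemma exists_unimodular_le_eLpNorm (k : ℕ) : ∃ a : ℕ → ℂ, (∀ n < 2 ^ k, ‖a n‖ = 1) ∧
    ∀ q : ℝ≥0∞, 1 ≤ q → ENNReal.ofReal (√(2 ^ k / 2)) ≤
      eLpNorm (fun t : ℝ => ∑ n ∈ Finset.range (2 ^ k), a n * Complex.exp (Complex.I * n * t)) q
        circleMeasure := by
  obtain ⟨a, b, ha, -, hab⟩ := exists_rudinShapiro k
  refine ⟨a, ha, fun q hq => ?_⟩
  set f : ℝ → ℂ := fun t => ∑ n ∈ Finset.range (2 ^ k), a n * Complex.exp (Complex.I * n * t)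
    with hf
  have hfT : f = T (2 ^ k) fun n => a n := by
    ext t
    unfold T
    rw [Fin.sum_univ_eq_sum_range (fun n => a n * Complex.exp (Complex.I * n * t))]
  have hcont : Continuous f := hfT ▸ continuous_T _ _
  refine le_trans ?_ (eLpNorm_le_eLpNorm_of_exponent_le hq hcont.aestronglyMeasurable)
  have hmem : MemLp f 1 circleMeasure := hfT ▸ memLp_T _ _ _
  rw [hmem.eLpNorm_eq_integral_rpow_norm one_ne_zero ENNReal.one_ne_top]
  refine ENNReal.ofReal_le_ofReal ?_
  simp only [ENNReal.toReal_one, Real.rpow_one, inv_one]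
  have hbound : ∀ t, ‖f t‖ ≤ √(2 * 2 ^ k) := fun t =>
    Real.le_sqrt_of_sq_le ((le_add_of_nonneg_right (sq_nonneg _)).trans_eq (hab t))
  have hL2 : ∫ t, ‖f t‖ ^ 2 ∂circleMeasure = 2 ^ k := by
    rw [hfT, integral_norm_sq_T (by positivity),
      Fin.sum_univ_eq_sum_range (fun n => ‖a n‖ ^ 2),
      Finset.sum_congr rfl fun n hn => by rw [ha n (Finset.mem_range.mp hn)]]
    simp
  -- `‖f‖² ≤ (sup ‖f‖) ‖f‖` pointwise: a flat function with known `L²` norm has large `L¹` norm.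
  have hle : (2 : ℝ) ^ k ≤ √(2 * 2 ^ k) * ∫ t, ‖f t‖ ∂circleMeasure := by
    rw [← hL2, ← integral_const_mul]
    refine integral_mono (integrable_circleMeasure (hcont.norm.pow 2))
      (integrable_circleMeasure (by fun_prop)) fun t => ?_
    dsimp only
    rw [sq]
    have := hbound t
    -- The earlier backward rewrite also replaced the `2 ^ k` under the square root; this restores
    -- it.
    rw [hL2]
    gcongr
  have hprod : √(2 * 2 ^ k) * √((2 : ℝ) ^ k / 2) = 2 ^ k := by
    rw [← Real.sqrt_mul (by positivity), show (2 * 2 ^ k * (2 ^ k / 2) : ℝ) = (2 ^ k) ^ 2 by ring,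
      Real.sqrt_sq (by positivity)]
  exact le_of_mul_le_mul_left (hprod.trans_le hle) (by positivity)

/-! ### Lower and upper bounds for the best constant -/

lemma natCast_rpow_eq_ofReal {N : ℕ} (hN : N ≠ 0) (r : ℝ) :
    (N : ℝ≥0∞) ^ r = ENNReal.ofReal ((N : ℝ) ^ r) := by
  rw [← ENNReal.ofReal_rpow_of_pos (by exact_mod_cast Nat.pos_of_ne_zero hN),
    ENNReal.ofReal_natCast]

lemma le_C_regionC {N : ℕ} (hN : N ≠ 0) {p q : ℝ≥0∞} (hp : 1 ≤ p) (hq : 1 ≤ q)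
    (hp2 : p⁻¹.toReal ≤ 1 / 2) :
    ENNReal.ofReal (1 / 2 * (N : ℝ) ^ (1 / 2 - p⁻¹.toReal)) ≤ C N p q := by
  set k := Nat.log 2 N
  set x := p⁻¹.toReal
  have hx : 0 ≤ x := ENNReal.toReal_nonneg
  have hKN : 2 ^ k ≤ N := Nat.pow_log_le_self 2 hN
  have hNK : N < 2 ^ (k + 1) := Nat.lt_pow_succ_log_self one_lt_two N
  obtain ⟨a, ha, hq'⟩ := exists_unimodular_le_eLpNorm k
  refine le_C_of_unimodular (by positivity) hKN a ha hp (le_trans ?_ (hq' q hq))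
  rw [natCast_rpow_eq_ofReal (by positivity), ← ENNReal.ofReal_mul (by positivity)]
  refine ENNReal.ofReal_le_ofReal ?_
  push_cast
  set K : ℝ := 2 ^ k with hK
  have hK0 : 0 < K := by positivity
  have hNK' : (N : ℝ) ≤ 2 * K := by
    have : (N : ℝ) ≤ ((2 ^ (k + 1) : ℕ) : ℝ) := by exact_mod_cast hNK.le
    rwa [pow_succ, mul_comm, Nat.cast_mul, Nat.cast_pow, Nat.cast_two] at this
  have h2 : (2 : ℝ) ^ (1 / 2 - x) ≤ √2 := by
    rw [Real.sqrt_eq_rpow]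
    exact Real.rpow_le_rpow_of_exponent_le one_le_two (by linarith)
  -- Truncating to `K = 2 ^ k` terms with `N ≤ 2K` costs at most `√2`, and the `L¹` bound `√(K/2)`
  -- costs another `√2`; hence the constant `1/2`.
  calc 1 / 2 * (N : ℝ) ^ (1 / 2 - x) * K ^ x
      ≤ 1 / 2 * (√2 * K ^ (1 / 2 - x)) * K ^ x := by
        gcongr
        refine (Real.rpow_le_rpow (by positivity) hNK' (by linarith)).trans ?_
        rw [Real.mul_rpow zero_le_two hK0.le]
        gcongr
    _ = √2 / 2 * √K := by
        rw [mul_assoc, mul_assoc, ← Real.rpow_add hK0, sub_add_cancel, ← Real.sqrt_eq_rpow]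
        ring
    _ = √(K / 2) := by
        rw [Real.sqrt_div_self', Real.sqrt_div hK0.le]
        ring

/-- The all-ones vector has `ℓ^p` norm `N ^ (1/p)`, and its sum is the Dirichlet kernel. -/
lemma le_C_regionB {N : ℕ} (hN : N ≠ 0) {p q : ℝ≥0∞} (hp : 1 ≤ p) (hq : 1 ≤ q) :
    ENNReal.ofReal (2 / Real.pi * (N : ℝ) ^ (1 - q⁻¹.toReal - p⁻¹.toReal)) ≤ C N p q := by
  have hN' : (0 : ℝ) < N := Nat.cast_pos.mpr (Nat.pos_of_ne_zero hN)
  refine le_C_of_unimodular hN le_rfl (fun _ => 1) (by simp) hp ?_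
  simp_rw [one_mul]
  refine le_trans (le_of_eq ?_) (le_eLpNorm_dirichlet hN (zero_lt_one.trans_le hq).ne')
  rw [ENNReal.inv_rpow, ← ENNReal.rpow_neg, natCast_rpow_eq_ofReal hN, natCast_rpow_eq_ofReal hN,
    ← ENNReal.ofReal_mul (by positivity), ← ENNReal.ofReal_mul (by positivity), mul_assoc,
    mul_assoc, ← Real.rpow_add hN']
  have h : (N : ℝ) * (N : ℝ) ^ (-q⁻¹.toReal) = (N : ℝ) ^ (1 + -q⁻¹.toReal) := by
    rw [Real.rpow_add hN', Real.rpow_one]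
  rw [h]
  congr 3
  ring

lemma one_le_C {N : ℕ} (hN : N ≠ 0) {p q : ℝ≥0∞} (hp : 1 ≤ p) (hq : 1 ≤ q) : 1 ≤ C N p q := by
  refine le_C_of_unimodular one_ne_zero (Nat.pos_of_ne_zero hN) (fun _ => 1) (by simp) hp ?_
  simp [eLpNorm_const _ (zero_lt_one.trans_le hq).ne' (IsProbabilityMeasure.ne_zero _)]

lemma C_le_rpow {N : ℕ} (hN : N ≠ 0) {p q r s : ℝ≥0∞} (hr1 : 1 ≤ r) (hr2 : r ≤ 2)
    (hrs : r⁻¹ + s⁻¹ = 1) (hqs : q ≤ s) (hrp : r ≤ p) :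
    C N p q ≤ ENNReal.ofReal ((N : ℝ) ^ (r⁻¹.toReal - p⁻¹.toReal)) := by
  rw [← natCast_rpow_eq_ofReal hN]
  refine C_le fun a => ?_
  exact (eLpNorm_le_eLpNorm_of_exponent_le hqs (continuous_T N a).aestronglyMeasurable).trans
    ((eLpNorm_T_le hN a hr1 hr2 hrs).trans (ofReal_norm_toLp_le a hr1 hrp))

lemma inv_ne_top_of_one_le {p : ℝ≥0∞} (hp : 1 ≤ p) : p⁻¹ ≠ ∞ :=
  ENNReal.inv_ne_top.mpr (zero_lt_one.trans_le hp).ne'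

lemma le_iff_toReal_inv_le {p q : ℝ≥0∞} (hp : 1 ≤ p) (hq : 1 ≤ q) :
    p ≤ q ↔ q⁻¹.toReal ≤ p⁻¹.toReal := by
  rw [ENNReal.toReal_le_toReal (inv_ne_top_of_one_le hq) (inv_ne_top_of_one_le hp),
    ENNReal.inv_le_inv]

lemma exists_conjugate {p : ℝ≥0∞} (hp : 1 ≤ p) :
    ∃ q : ℝ≥0∞, 1 ≤ q ∧ p⁻¹ + q⁻¹ = 1 ∧ q⁻¹.toReal = 1 - p⁻¹.toReal := by
  have hp' : p⁻¹ ≤ 1 := ENNReal.inv_le_one.mpr hp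
  refine ⟨(1 - p⁻¹)⁻¹, ?_, ?_, ?_⟩
  · exact ENNReal.one_le_inv.mpr tsub_le_self
  · rw [inv_inv, add_tsub_cancel_of_le hp']
  · rw [inv_inv, ENNReal.toReal_sub_of_le hp' ENNReal.one_ne_top, ENNReal.toReal_one]

lemma regionA_union_regionB_union_regionC :
    regionA ∪ regionB ∪ regionC = Set.Icc (0 : ℝ) 1 ×ˢ Set.Icc (0 : ℝ) 1 := by
  ext ⟨x, y⟩
  simp only [regionA, regionB, regionC, Set.mem_union, Set.mem_ofPred_eq, Set.mem_prod, Set.mem_Icc]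
  constructor
  · rintro ((h | h) | h) <;> refine ⟨⟨?_, ?_⟩, ?_, ?_⟩ <;> linarith [h.1, h.2.1, h.2.2.1, h.2.2.2]
  · rintro ⟨⟨h1, h2⟩, h3, h4⟩
    by_cases hA : 1 / 2 ≤ x ∧ 1 - x ≤ y
    · exact Or.inl (Or.inl ⟨hA.1, h2, hA.2, h4⟩)
    · by_cases hy : y ≤ 1 / 2
      · refine Or.inl (Or.inr ⟨h3, hy, h1, ?_⟩)
        by_contra hx
        exact hA ⟨by linarith, by linarith⟩
      · refine Or.inr ⟨h1, ?_, by linarith, h4⟩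
        by_contra hx
        exact hA ⟨by linarith, by linarith⟩

end TrigSum

theorem theorem1 :
    TrigSum.regionA ∪ TrigSum.regionB ∪ TrigSum.regionC =
        Set.Icc (0 : ℝ) 1 ×ˢ Set.Icc (0 : ℝ) 1 ∧
    ∃ cB cC : ℝ, 0 < cB ∧ 0 < cC ∧ cB = 2 / Real.pi ∧
      ∀ (N : ℕ) (p q : ℝ≥0∞), 1 ≤ N → 1 ≤ p → 1 ≤ q →
        (TrigSum.point p q ∈ TrigSum.regionA → TrigSum.C N p q = 1) ∧
        (TrigSum.point p q ∈ TrigSum.regionB →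
          ENNReal.ofReal (cB * (N : ℝ) ^ (1 - (q⁻¹).toReal - (p⁻¹).toReal)) ≤
              TrigSum.C N p q ∧
            TrigSum.C N p q ≤
              ENNReal.ofReal ((N : ℝ) ^ (1 - (q⁻¹).toReal - (p⁻¹).toReal))) ∧
        (TrigSum.point p q ∈ TrigSum.regionC →
          ENNReal.ofReal (cC * (N : ℝ) ^ (1 / 2 - (p⁻¹).toReal)) ≤ TrigSum.C N p q ∧
            TrigSum.C N p q ≤ ENNReal.ofReal ((N : ℝ) ^ (1 / 2 - (p⁻¹).toReal))) := by
  refine ⟨TrigSum.regionA_union_regionB_union_regionC, 2 / Real.pi, 1 / 2,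
    div_pos two_pos Real.pi_pos, by norm_num, rfl, fun N p q hN hp hq => ?_⟩
  have hN0 : N ≠ 0 := Nat.one_le_iff_ne_zero.mp hN
  have h2 : ((2 : ℝ≥0∞)⁻¹).toReal = 1 / 2 := by simp
  have h12 : (1 : ℝ≥0∞) ≤ 2 := one_le_two
  refine ⟨fun h => ?_, fun h => ⟨TrigSum.le_C_regionB hN0 hp hq, ?_⟩,
    fun h => ⟨TrigSum.le_C_regionC hN0 hp hq h.2.1, ?_⟩⟩
  · obtain ⟨hx, -, hy, -⟩ := h
    simp only [TrigSum.point] at hx hy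
    obtain ⟨s, hs, hps, hs'⟩ := TrigSum.exists_conjugate hp
    refine le_antisymm ?_ (TrigSum.one_le_C hN0 hp hq)
    -- Region 𝒜: `r = p` makes the exponent of `N` vanish, and `1 - x ≤ y` says `q ≤ p'`.
    have := TrigSum.C_le_rpow hN0 hp ((TrigSum.le_iff_toReal_inv_le hp h12).mpr (h2 ▸ hx)) hps
      ((TrigSum.le_iff_toReal_inv_le hq hs).mpr (hs' ▸ hy)) le_rfl
    simpa using this
  · obtain ⟨-, hy, -, hx⟩ := h
    simp only [TrigSum.point] at hx hy
    obtain ⟨r, hr, hqr, hr'⟩ := TrigSum.exists_conjugate hq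
    -- Region ℬ: `s = q` and `r = q'`; the condition `x ≤ 1 - y` says `q' ≤ p`.
    have := TrigSum.C_le_rpow hN0 hr
      ((TrigSum.le_iff_toReal_inv_le hr h12).mpr (by rw [h2, hr']; linarith))
      ((add_comm _ _).trans hqr) le_rfl ((TrigSum.le_iff_toReal_inv_le hr hp).mpr (hr' ▸ hx))
    rwa [hr'] at this
  · obtain ⟨-, hx, hy, -⟩ := h
    simp only [TrigSum.point] at hx hy
    -- Region 𝒞: `r = s = 2`, since `q ≤ 2 ≤ p`.
    have := TrigSum.C_le_rpow hN0 h12 le_rfl ENNReal.inv_two_add_inv_two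
      ((TrigSum.le_iff_toReal_inv_le hq h12).mpr (h2 ▸ hy))
      ((TrigSum.le_iff_toReal_inv_le h12 hp).mpr (h2 ▸ hx))
    rwa [h2] at this
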